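/- For integers $m,n$, let $$BS(m,n)=\langle \tau,b \mid \tau^{-1}b^m\tau=b^n\rangle$$ be the Baumslag--Solitar group, let $\sigma:BS(m,n)\to\mathbf Z$ be the homomorphism defined by $\sigma(\tau)=1$ and $\sigma(b)=0$, and let $SBS(m,n)=\ker\sigma$. A group $\Gamma$ is a *Powers group* if it is not reduced to one element and if, for every finite subset $F\subset\Gamma\smallsetminus\{1\}$ and every integer $N\ge 1$, there exist a partition $\Gamma=C\sqcup D$ and elements $\gamma_1,\dots,\gamma_N\in\Gamma$ such that $fC\cap C=\emptyset$ for all $f\in F$ and $\gamma_jD\cap\gamma_kD=\emptyset$ for all $j,k\in\{1,\dots,N\}$ with $j\neq k$. A subgroup $N$ of $\Gamma$ is *subnormal* if there is a finite chain of subgroups $N=N_0\le N_1\le\cdots\le N_k=\Gamma$ with $N_{j-1}$ normal in $N_j$ for $j=1,\dots,k$. A group $\Gamma$ is a *strongly Powers group* if every subnormal subgroup $N\neq\{1\}$ of $\Gamma$ is a Powers group. **Corollary 1.7.** Let $m,n$ be integers. If $\min\{|m|,|n|\}\ge 2$ and $|m|\ne|n|$, then $SBS(m,n)$ is a strongly Powers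 group. -/

import Mathlib

open scoped Pointwise

/-- A group `G` is a Powers group if it is not reduced to one element and if, for every finite
set `F` of non-trivial elements and every integer `N ≥ 1`, there are a partition `G = C ⊔ D` and
elements `γ₁, …, γ_N` of `G` such that `f C ∩ C = ∅` for all `f ∈ F` and
`γⱼ D ∩ γₖ D = ∅` for all `j ≠ k`. -/
def IsPowersGroup (G : Type*) [Group G] : Prop :=
  Nontrivial G ∧
    ∀ F : Finset G, (1 : G) ∉ F → ∀ N : ℕ, 1 ≤ N →
      ∃ (C D : Set G) (γ : Fin N → G),
        C ∪ D = Set.univ ∧ C ∩ D = ∅ ∧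
        (∀ f ∈ F, (f • C) ∩ C = ∅) ∧
        (∀ j k : Fin N, j ≠ k → (γ j • D) ∩ (γ k • D) = ∅)

/-- A group is a strongly Powers group if each of its non-trivial subnormal subgroups is a
Powers group. -/
def IsStronglyPowersGroup (G : Type*) [Group G] : Prop :=
  ∀ N : Subgroup G, N.IsSubnormal → N ≠ ⊥ → IsPowersGroup N

namespace BaumslagSolitar

/-- The two generators of a Baumslag-Solitar group. -/
inductive Gen : Type
  | τ : Gen
  | b : Gen

/-- The relator `τ⁻¹ b^m τ (b^n)⁻¹`, an element of the free group on `τ, b`. -/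
def relator (m n : ℤ) : FreeGroup Gen :=
  (FreeGroup.of Gen.τ)⁻¹ * FreeGroup.of Gen.b ^ m * FreeGroup.of Gen.τ *
    (FreeGroup.of Gen.b ^ n)⁻¹

/-- The Baumslag-Solitar group `BS(m,n) = ⟨τ, b ∣ τ⁻¹ b^m τ = b^n⟩`. -/
abbrev BS (m n : ℤ) : Type := PresentedGroup {relator m n}

/-- The values on generators of the homomorphism `σ`. -/
def σGen : Gen → Multiplicative ℤ
  | Gen.τ => Multiplicative.ofAdd 1
  | Gen.b => Multiplicative.ofAdd 0

theorem lift_σGen_relator (m n : ℤ) :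
    ∀ r ∈ ({relator m n} : Set (FreeGroup Gen)), FreeGroup.lift σGen r = 1 := by
  rintro r rfl
  simp [relator, σGen]

/-- The homomorphism `σ : BS(m,n) → ℤ` with `σ(τ) = 1` and `σ(b) = 0`
(with `ℤ` written multiplicatively). -/
def σ (m n : ℤ) : BS m n →* Multiplicative ℤ :=
  PresentedGroup.toGroup (lift_σGen_relator m n)

/-- The special Baumslag-Solitar group `SBS(m,n) = ker σ`. -/
abbrev SBS (m n : ℤ) : Subgroup (BS m n) := (σ m n).ker

end BaumslagSolitar

/-! `BS m n` is an HNN extension of `⟨b⟩ ≅ ℤ` with stable letter `t = τ⁻¹`. It acts by left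
translation on that extension, and the translates of half-trees (the elements whose reduced word
begins with a given edge of the Bass–Serre tree) form a family `𝓑`. No boundary of the tree is
needed.

Two properties of `𝓑` suffice. Displacement concerns all non-trivial elements of the ambient group,
so it serves every subgroup at once. Compression of complements depends on the subgroup, but
ping-pong with conjugates passes it to non-trivial normal subgroups
(`CompressesComplements.of_normal`), hence down subnormal chains. Together they give the Powers
property.

Since `|m|, |n| ≥ 2`, `b` lies in neither associated subgroup, so the tree branches enough for
compression. Since `|m| ≠ |n|`, conjugation by powers of `t` moves any non-trivial power of `b` out
of `⟨b⟩`; this faithfulness gives displacement. -/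

theorem IsPowersGroup.of_mulEquiv {G H : Type*} [Group G] [Group H] (h : IsPowersGroup G)
    (e : G ≃* H) : IsPowersGroup H := by
  classical
  obtain ⟨hnt, h⟩ := h
  refine ⟨e.symm.toEquiv.nontrivial, fun F hF N hN => ?_⟩
  obtain ⟨C, D, γ, hU, hI, hC, hD⟩ := h (F.image e.symm) (by
    simpa [Finset.mem_image, MulEquiv.symm_apply_eq] using hF) N hN
  have hsmul : ∀ (g : G) (S : Set G), e '' (g • S) = e g • e '' S := fun g S =>
    Set.image_smul_distrib e g S
  refine ⟨e '' C, e '' D, fun i => e (γ i), ?_, ?_, ?_, ?_⟩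
  · rw [← Set.image_union, hU, Set.image_univ, e.surjective.range_eq]
  · rw [← Set.image_inter e.injective, hI, Set.image_empty]
  · intro f hf
    have := hC _ (Finset.mem_image_of_mem _ hf)
    rw [← e.apply_symm_apply f, ← hsmul, ← Set.image_inter e.injective, this, Set.image_empty]
  · intro j k hjk
    rw [← hsmul, ← hsmul, ← Set.image_inter e.injective, hD j k hjk, Set.image_empty]

/-! ### Ping-pong criterion for strongly Powers groups -/

section PingPong

variable {G X : Type*} [Group G] [MulAction G X]

/-- Every set of the family `𝓑` has a complement which is sent into that set by all the non-trivial
powers of some element of `H`. -/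
def CompressesComplements (H : Subgroup G) (𝓑 : Set (Set X)) : Prop :=
  ∀ U ∈ 𝓑, ∃ g ∈ H, ∀ j : ℤ, j ≠ 0 → ∀ x ∉ U, g ^ j • x ∈ U

variable (G) in
/-- Every set of the family `𝓑` contains, for each non-trivial `f`, a smaller set of `𝓑` which is
displaced by `f`. -/
def IsDisplacing (𝓑 : Set (Set X)) : Prop :=
  ∀ f : G, f ≠ 1 → ∀ U ∈ 𝓑, ∃ V ∈ 𝓑, V ⊆ U ∧ ∀ x ∈ V, f • x ∉ V

theorem IsDisplacing.exists_forall_mem_finset {𝓑 : Set (Set X)} (hd : IsDisplacing G 𝓑)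
    {U : Set X} (hU : U ∈ 𝓑) (F : Finset G) (hF : (1 : G) ∉ F) :
    ∃ V ∈ 𝓑, V ⊆ U ∧ ∀ f ∈ F, ∀ x ∈ V, f • x ∉ V := by
  classical
  induction F using Finset.induction_on with
  | empty => exact ⟨U, hU, subset_rfl, by simp⟩
  | insert f F _ ih =>
    rw [Finset.mem_insert, not_or] at hF
    obtain ⟨V, hV, hVU, hFV⟩ := ih hF.2
    obtain ⟨W, hW, hWV, hfW⟩ := hd f (Ne.symm hF.1) V hV
    refine ⟨W, hW, hWV.trans hVU, fun f' hf' x hx hx' => ?_⟩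
    rcases Finset.mem_insert.1 hf' with rfl | hf'
    · exact hfW x hx hx'
    · exact hFV f' hf' x (hWV hx) (hWV hx')

/-- The partition is pulled back along an orbit map from `V` and its complement, where `V` is
displaced by all of `F`. The translating elements are the powers of a single `g` compressing the
complement of `V`. -/
theorem CompressesComplements.isPowersGroup [Nonempty X] {H : Subgroup G} {𝓑 : Set (Set X)}
    (h𝓑 : 𝓑.Nonempty) (hd : IsDisplacing G 𝓑) (hc : CompressesComplements H 𝓑) (hH : H ≠ ⊥) :
    IsPowersGroup H := by
  classical
  refine ⟨(Subgroup.nontrivial_iff_ne_bot H).2 hH, fun F hF N _ => ?_⟩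
  obtain ⟨U, hU⟩ := h𝓑
  obtain ⟨V, hV, -, hFV⟩ := hd.exists_forall_mem_finset hU (F.image (fun f : H => (f : G)))
    (by simpa using hF)
  obtain ⟨g, hgH, hg⟩ := hc V hV
  obtain ⟨x⟩ := ‹Nonempty X›
  refine ⟨{γ | (γ : G) • x ∈ V}, {γ | (γ : G) • x ∉ V}, fun i => ⟨g, hgH⟩ ^ (i : ℕ), ?_, ?_, ?_, ?_⟩
  · ext γ
    simpa using em _
  · ext γ
    simp
  · intro f hf
    refine Set.eq_empty_of_forall_notMem fun γ hγ => ?_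
    obtain ⟨⟨δ, hδ, rfl⟩, hγ⟩ := hγ
    refine hFV f (Finset.mem_image_of_mem _ hf) _ hδ ?_
    simpa [mul_smul] using hγ
  · intro j k hjk
    refine Set.eq_empty_of_forall_notMem fun γ hγ => ?_
    obtain ⟨⟨δ, hδ, rfl⟩, ⟨ε, hε, h⟩⟩ := hγ
    have hjk' : (k : ℤ) - j ≠ 0 := by
      rw [sub_ne_zero]
      exact fun h => hjk (Fin.ext (by exact_mod_cast h.symm))
    have h' := congrArg (fun γ : H => (γ : G)) h
    simp only [smul_eq_mul, Subgroup.coe_mul, SubmonoidClass.coe_pow] at h'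
    have key := hg _ hjk' _ hε
    rw [sub_eq_neg_add, zpow_add, mul_smul, zpow_natCast, ← mul_smul (g ^ (k : ℕ)), h', ← mul_smul,
      zpow_neg, zpow_natCast, inv_mul_cancel_left] at key
    exact hδ key

theorem pingpong_pow_mem {A B : Set X} (hAB : ∀ x ∈ A, x ∉ B) {a b : G}
    (ha : ∀ x ∉ A, a • x ∈ A) (hb : ∀ x ∉ B, b • x ∈ B) (n : ℕ) {x : X} (hx : x ∉ B) :
    (a * b) ^ (n + 1) • x ∈ A := by
  induction n generalizing x with
  | zero =>
    rw [zero_add, pow_one, mul_smul]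
    exact ha _ fun h => hAB _ h (hb x hx)
  | succ n ih =>
    rw [pow_succ, mul_smul]
    refine ih fun h => ?_
    rw [mul_smul] at h
    exact hAB _ (ha _ fun h => hAB _ h (hb x hx)) h

theorem pingpong_zpow_mem {A B : Set X} (hAB : ∀ x ∈ A, x ∉ B) {a b : G}
    (ha : ∀ x ∉ A, a • x ∈ A) (ha' : ∀ x ∉ A, a⁻¹ • x ∈ A)
    (hb : ∀ x ∉ B, b • x ∈ B) (hb' : ∀ x ∉ B, b⁻¹ • x ∈ B) {j : ℤ} (hj : j ≠ 0) {x : X}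
    (hxA : x ∉ A) (hxB : x ∉ B) : (a * b) ^ j • x ∈ A ∪ B := by
  rcases j with (_ | n) | n
  · exact absurd rfl hj
  · left
    rw [Int.ofNat_eq_natCast, zpow_natCast]
    exact pingpong_pow_mem hAB ha hb n hxB
  · right
    rw [zpow_negSucc, ← inv_pow, mul_inv_rev]
    exact pingpong_pow_mem (fun x hB hA => hAB x hA hB) hb' ha' n hxA

/-- Let `f ∈ K` displace `W ⊆ U` and let `g ∈ H` compress the complement of `W`. The sets `g ^ i (X
\ W)`, `i = 1, 2`, are disjoint and lie in `W`. The conjugate of `f` by `g ^ i`, and its inverse,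
send the complement of the `i`-th set into that set. Ping-pong then controls all powers of the
product of the two conjugates. -/
theorem CompressesComplements.of_normal {H K : Subgroup G} {𝓑 : Set (Set X)}
    (hd : IsDisplacing G 𝓑) (hc : CompressesComplements H 𝓑)
    (hK : ∀ k ∈ K, ∀ h ∈ H, h * k * h⁻¹ ∈ K) (hne : K ≠ ⊥) : CompressesComplements K 𝓑 := by
  intro U hU
  obtain ⟨f, hfK, hf⟩ := K.bot_or_exists_ne_one.resolve_left hne
  obtain ⟨W, hW, hWU, hfW⟩ := hd f hf U hU
  obtain ⟨g, hgH, hg⟩ := hc W hW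
  have hfW' : ∀ x ∈ W, f⁻¹ • x ∉ W := fun x hx h => hfW _ h (by simpa using hx)
  have hconj : ∀ (h f : G), (∀ x ∈ W, f • x ∉ W) → ∀ x ∉ {y | h⁻¹ • y ∉ W},
      (h * f * h⁻¹) • x ∈ {y | h⁻¹ • y ∉ W} := by
    intro h f hf x hx
    simp only [Set.mem_ofPred_eq, not_not] at hx ⊢
    rw [mul_smul, mul_smul, inv_smul_smul]
    exact hf _ hx
  have hconj' : ∀ (h f : G), (∀ x ∈ W, f⁻¹ • x ∉ W) → ∀ x ∉ {y | h⁻¹ • y ∉ W},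
      (h * f * h⁻¹)⁻¹ • x ∈ {y | h⁻¹ • y ∉ W} := by
    intro h f hf
    have := hconj h f⁻¹ hf
    simpa [mul_assoc] using this
  have hsub : ∀ j : ℤ, j ≠ 0 → ∀ x, (g ^ j)⁻¹ • x ∉ W → x ∈ W := by
    intro j hj x hx
    simpa using hg j hj _ hx
  refine ⟨(g ^ (1 : ℤ) * f * (g ^ (1 : ℤ))⁻¹) * (g ^ (2 : ℤ) * f * (g ^ (2 : ℤ))⁻¹),
    K.mul_mem (hK _ hfK _ (H.zpow_mem hgH _)) (hK _ hfK _ (H.zpow_mem hgH _)),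
    fun j hj x hx => ?_⟩
  have hxW : x ∉ W := fun h => hx (hWU h)
  have := pingpong_zpow_mem (A := {y | (g ^ (1 : ℤ))⁻¹ • y ∉ W})
    (B := {y | (g ^ (2 : ℤ))⁻¹ • y ∉ W}) (fun x hx hx' => ?_)
    (hconj _ _ hfW) (hconj' _ _ hfW') (hconj _ _ hfW) (hconj' _ _ hfW') hj
    (fun h => hxW (hsub 1 one_ne_zero x h)) (fun h => hxW (hsub 2 two_ne_zero x h))
  · rcases this with h | h
    · exact hWU (hsub 1 one_ne_zero _ h)
    · exact hWU (hsub 2 two_ne_zero _ h)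
  -- Disjointness: if `g⁻¹ • x ∉ W`, then `g⁻¹` compresses this point, so `g⁻² • x ∈ W`.
  · have := hg (-1) (by decide) _ hx
    refine hx' ?_
    rw [← zpow_neg, ← mul_smul, ← zpow_add] at this
    rwa [← zpow_neg]

theorem IsDisplacing.isStronglyPowersGroup [Nonempty X] {H : Subgroup G} {𝓑 : Set (Set X)}
    (h𝓑 : 𝓑.Nonempty) (hd : IsDisplacing G 𝓑) (hc : CompressesComplements H 𝓑) :
    IsStronglyPowersGroup H := by
  suffices ∀ N : Subgroup H, N.IsSubnormal → N ≠ ⊥ →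
      CompressesComplements (N.map H.subtype) 𝓑 by
    intro N hN hne
    have hne' : N.map H.subtype ≠ ⊥ := by
      rwa [Ne, Subgroup.map_eq_bot_iff_of_injective _ H.subtype_injective]
    have hP := (this N hN hne).isPowersGroup h𝓑 hd hne'
    exact hP.of_mulEquiv (N.equivMapOfInjective _ H.subtype_injective).symm
  intro N hN
  induction hN with
  | top =>
    intro _
    rwa [← MonoidHom.range_eq_map, Subgroup.range_subtype]
  | step N K hle _ hnormal ih =>
    intro hne
    refine (ih fun h => hne (by simpa [h] using hle)).of_normal hd ?_ (by
      rwa [Ne, Subgroup.map_eq_bot_iff_of_injective _ H.subtype_injective])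
    rintro _ ⟨n, hn, rfl⟩ _ ⟨k, hk, rfl⟩
    refine ⟨k * n * k⁻¹, ?_, by simp⟩
    exact (Subgroup.normal_subgroupOf_iff hle).1 hnormal n k hn hk

end PingPong

/-! ### Half-trees in an HNN extension -/

namespace HNNExtension

open NormalWord

variable {G : Type*} [Group G] {A B : Subgroup G} {φ : A ≃* B}

variable (φ) in
/-- The elements having a reduced word which starts with `h * t ^ u`, where `h` lies in the same
coset of the relevant associated subgroup as `g`. -/
def halfTree (g : G) (u : ℤˣ) : Set (HNNExtension G A B φ) :=
  {x | ∃ w : ReducedWord G A B, w.prod φ = x ∧ w.toList.head?.map Prod.fst = some u ∧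
    g⁻¹ * w.head ∈ toSubgroup A B (-u)}

theorem exists_reducedWord_prod_eq (x : HNNExtension G A B φ) :
    ∃ w : ReducedWord G A B, w.prod φ = x := by
  obtain ⟨d⟩ := TransversalPair.nonempty G A B
  exact ⟨(x • (NormalWord.empty : NormalWord d)).toReducedWord, by
    rw [prod_smul, prod_empty, mul_one]⟩

theorem of_mul_mem_halfTree (h : G) {g : G} {u : ℤˣ} {x : HNNExtension G A B φ}
    (hx : x ∈ halfTree φ g u) : of h * x ∈ halfTree φ (h * g) u := by
  obtain ⟨w, rfl, hw, hg⟩ := hx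
  refine ⟨⟨h * w.head, w.toList, w.chain⟩, ?_, hw, by simpa [mul_assoc] using hg⟩
  simp [ReducedWord.prod, mul_assoc]

/-- Britton's lemma: an element determines the first exponent of its reduced words and the coset of
their head, so distinct edges at the base vertex bound disjoint half-trees. -/
theorem eq_and_mem_of_mem_halfTree {g g' : G} {u u' : ℤˣ} {x : HNNExtension G A B φ}
    (hx : x ∈ halfTree φ g u) (hx' : x ∈ halfTree φ g' u') :
    u = u' ∧ g⁻¹ * g' ∈ toSubgroup A B (-u) := by
  obtain ⟨w, hw, hu, hg⟩ := hx
  obtain ⟨w', hw', hu', hg'⟩ := hx'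
  obtain ⟨h1, h2⟩ := ReducedWord.map_fst_eq_and_of_prod_eq φ (hw.trans hw'.symm)
  have huu : u = u' := by
    have := congrArg List.head? h1
    rwa [List.head?_map, List.head?_map, hu, hu', Option.some_inj] at this
  subst huu
  refine ⟨rfl, ?_⟩
  have := mul_mem (mul_mem hg (h2 u (by simp [hu]))) (inv_mem hg')
  simpa [mul_assoc] using this

/-- Prefixing `t ^ u` to a reduced word fails to be reduced only when the word starts with an
element of `toSubgroup A B u` followed by `t ^ (-u)`, which is the excluded half-tree. -/
theorem t_zpow_mul_mem_halfTree {u : ℤˣ} {x : HNNExtension G A B φ}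
    (hx : x ∉ halfTree φ 1 (-u)) : t ^ (u : ℤ) * x ∈ halfTree φ 1 u := by
  obtain ⟨w, rfl⟩ := exists_reducedWord_prod_eq x
  refine ⟨⟨1, (u, w.head) :: w.toList, List.isChain_cons.2 ⟨fun y hy hmem => ?_, w.chain⟩⟩, ?_,
    rfl, by simp⟩
  · by_contra hne
    refine hx ⟨w, rfl, ?_, by simpa using hmem⟩
    rw [Option.mem_def] at hy
    rw [hy, Option.map_some, ← Int.units_ne_iff_eq_neg.1 (Ne.symm hne)]
  · simp [ReducedWord.prod, mul_assoc]

theorem t_zpow_inv_mul_mem_halfTree {u : ℤˣ} {x : HNNExtension G A B φ}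
    (hx : x ∉ halfTree φ 1 u) : (t ^ (u : ℤ))⁻¹ * x ∈ halfTree φ 1 (-u) := by
  by_contra h
  exact hx (by simpa using t_zpow_mul_mem_halfTree h)

theorem notMem_halfTree_neg {g g' : G} {u : ℤˣ} {x : HNNExtension G A B φ}
    (hx : x ∈ halfTree φ g u) : x ∉ halfTree φ g' (-u) := fun h =>
  neg_units_ne_self u (eq_and_mem_of_mem_halfTree hx h).1.symm

theorem halfTree_disjoint_of_notMem {a g : G} (u v : ℤˣ) (ha : ∀ u, a ∉ toSubgroup A B u)
    {x : HNNExtension G A B φ} (hx : x ∈ halfTree φ (g * a) u) : x ∉ halfTree φ g v := by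
  intro h
  have := (eq_and_mem_of_mem_halfTree hx h).2
  exact ha _ (by simpa using inv_mem this)

theorem t_zpow_pow_mul_mem_halfTree {u : ℤˣ} (n : ℕ) {x : HNNExtension G A B φ}
    (hx : x ∉ halfTree φ 1 (-u)) : (t ^ (u : ℤ)) ^ (n + 1) * x ∈ halfTree φ 1 u := by
  induction n with
  | zero => simpa using t_zpow_mul_mem_halfTree hx
  | succ n ih =>
    rw [pow_succ', mul_assoc]
    exact t_zpow_mul_mem_halfTree (notMem_halfTree_neg ih)

/-- Only cancellation with the last letter of the word can spoil the product, and one half-tree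
`(g', u')` accounts for it. Further left, the word being reduced prevents cancellation. -/
theorem exists_of_mul_prod_mul_mem_halfTree (u : ℤˣ) (g : G) (l : List (ℤˣ × G))
    (hl : ((u, g) :: l).IsChain (fun a b => a.2 ∈ toSubgroup A B a.1 → a.1 = b.1)) :
    ∃ g' u', ∀ x ∉ halfTree φ g' u', ∀ h : G,
      of h * ((((u, g) :: l).map fun y => t ^ (y.1 : ℤ) * of y.2).prod * x) ∈ halfTree φ h u := by
  have key : ∀ x : HNNExtension G A B φ, of g * x ∉ halfTree φ 1 (-u) → ∀ h : G,
      of h * (t ^ (u : ℤ) * (of g * x)) ∈ halfTree φ h u := by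
    intro x hx h
    simpa using of_mul_mem_halfTree h (t_zpow_mul_mem_halfTree hx)
  induction l generalizing u g with
  | nil =>
    refine ⟨g⁻¹, -u, fun x hx h => ?_⟩
    have := key x (fun h' => hx (by simpa using of_mul_mem_halfTree g⁻¹ h')) h
    simpa [mul_assoc] using this
  | cons y l ih =>
    obtain ⟨u₂, g₂⟩ := y
    rw [List.isChain_cons_cons] at hl
    obtain ⟨g', u', H⟩ := ih u₂ g₂ hl.2 (fun x hx h => by
      simpa using of_mul_mem_halfTree h (t_zpow_mul_mem_halfTree hx))
    refine ⟨g', u', fun x hx h => ?_⟩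
    have := key ((((u₂, g₂) :: l).map fun y => t ^ (y.1 : ℤ) * of y.2).prod * x)
      (fun h' => ?_) h
    · simpa [mul_assoc] using this
    · obtain ⟨h1, h2⟩ := eq_and_mem_of_mem_halfTree (H x hx g) h'
      subst h1
      exact neg_units_ne_self u (hl.1 (by simpa using h2)).symm

theorem exists_mul_mem_halfTree (y : HNNExtension G A B φ)
    (hy : y ∉ (of.range : Subgroup (HNNExtension G A B φ))) :
    ∃ g u g' u', ∀ x ∉ halfTree φ g' u', y * x ∈ halfTree φ g u := by
  obtain ⟨⟨h, l, hl⟩, rfl⟩ := exists_reducedWord_prod_eq y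
  cases l with
  | nil => exact absurd ⟨h, by simp [ReducedWord.prod]⟩ hy
  | cons y l =>
    obtain ⟨g', u', H⟩ := exists_of_mul_prod_mul_mem_halfTree (φ := φ) y.1 y.2 l hl
    exact ⟨h, y.1, g', u', fun x hx => by
      simpa [ReducedWord.prod, mul_assoc] using H x hx h⟩

variable (φ) in
/-- The translates of the half-trees. -/
def halfTrees : Set (Set (HNNExtension G A B φ)) :=
  {U | ∃ (h : HNNExtension G A B φ) (g : G) (u : ℤˣ), U = {x | h * x ∈ halfTree φ g u}}

theorem exists_halfTrees_eq {U : Set (HNNExtension G A B φ)} (hU : U ∈ halfTrees φ) :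
    ∃ (h : HNNExtension G A B φ) (u : ℤˣ), U = {x | h * x ∈ halfTree φ 1 u} := by
  obtain ⟨h, g, u, rfl⟩ := hU
  refine ⟨of g⁻¹ * h, u, Set.ext fun x => ⟨fun hx => ?_, fun hx => ?_⟩⟩
  · simpa [mul_assoc] using of_mul_mem_halfTree g⁻¹ hx
  · simpa [mul_assoc] using of_mul_mem_halfTree g hx

/-- Each of `a⁻¹` and `a` moves the current half-tree off those at the trivial coset, so neither the
following `t ^ j` nor the final `t ^ u` can cancel. -/
theorem zpow_conj_mul_mem_halfTree {a : G} (ha : ∀ u, a ∉ toSubgroup A B u) (u : ℤˣ) {j : ℤ}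
    (hj : j ≠ 0) {x : HNNExtension G A B φ} (hx : x ∉ halfTree φ 1 u) :
    (t ^ (u : ℤ) * of a) * t ^ j * (t ^ (u : ℤ) * of a)⁻¹ * x ∈ halfTree φ 1 u := by
  have ha' : ∀ u, a⁻¹ ∉ toSubgroup A B u := fun u h => ha u (by simpa using h)
  have h1 : of a⁻¹ * ((t ^ (u : ℤ))⁻¹ * x) ∈ halfTree φ (1 * a⁻¹) (-u) := by
    simpa using of_mul_mem_halfTree a⁻¹ (t_zpow_inv_mul_mem_halfTree hx)
  have h2 : ∃ v, t ^ j * (of a⁻¹ * ((t ^ (u : ℤ))⁻¹ * x)) ∈ halfTree φ 1 v := by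
    rcases j with (_ | n) | n
    · exact absurd rfl hj
    · refine ⟨1, ?_⟩
      have := t_zpow_pow_mul_mem_halfTree (u := 1) n (halfTree_disjoint_of_notMem _ (-1) ha' h1)
      rw [Int.ofNat_eq_natCast, zpow_natCast]
      simpa using this
    · refine ⟨-1, ?_⟩
      have := t_zpow_pow_mul_mem_halfTree (u := -1) n
        (halfTree_disjoint_of_notMem _ (-(-1)) ha' h1)
      rw [zpow_negSucc, ← inv_pow]
      simpa using this
  obtain ⟨v, hv⟩ := h2
  have h3 := of_mul_mem_halfTree a hv
  have h4 := t_zpow_mul_mem_halfTree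
    (halfTree_disjoint_of_notMem (g := 1) v (-u) ha (by simpa using h3))
  simpa [mul_assoc] using h4

theorem compressesComplements_halfTrees {a : G} (ha : ∀ u, a ∉ toSubgroup A B u) :
    CompressesComplements (⊤ : Subgroup (HNNExtension G A B φ)) (halfTrees φ) := by
  intro U hU
  obtain ⟨h, u, rfl⟩ := exists_halfTrees_eq hU
  refine ⟨h⁻¹ * ((t ^ (u : ℤ) * of a) * t * (t ^ (u : ℤ) * of a)⁻¹) * h, trivial,
    fun j hj x hx => ?_⟩
  have hconj := conj_zpow (a := h⁻¹) (b := (t ^ (u : ℤ) * of a) * t * (t ^ (u : ℤ) * of a)⁻¹) (i := j)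
  rw [inv_inv] at hconj
  rw [hconj, conj_zpow]
  have := zpow_conj_mul_mem_halfTree ha u hj hx
  simpa [mul_assoc] using this

/-- Pigeonhole: the half-trees at `1` and `a` with exponents `±1` are four in number, and each of
the three given half-trees meets at most one of them. -/
theorem exists_forall_notMem_halfTree {a : G} (ha : ∀ u, a ∉ toSubgroup A B u)
    (g₁ g₂ g₃ : G) (u₁ u₂ u₃ : ℤˣ) :
    ∃ (c : G) (v : ℤˣ), ∀ x ∈ halfTree φ c v,
      x ∉ halfTree φ g₁ u₁ ∧ x ∉ halfTree φ g₂ u₂ ∧ x ∉ halfTree φ g₃ u₃ := by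
  have key : ∀ (g : G) (u v v' : ℤˣ), (∃ x ∈ halfTree φ 1 v, x ∈ halfTree φ g u) →
      (∃ x ∈ halfTree φ a v', x ∈ halfTree φ g u) → False := by
    rintro g u v v' ⟨x, hx, hx'⟩ ⟨y, hy, hy'⟩
    obtain ⟨-, h1⟩ := eq_and_mem_of_mem_halfTree hx' hx
    obtain ⟨-, h2⟩ := eq_and_mem_of_mem_halfTree hy' hy
    exact ha _ (by simpa using mul_mem (inv_mem h1) h2)
  have key' : ∀ (g c : G) (u : ℤˣ), (∃ x ∈ halfTree φ c 1, x ∈ halfTree φ g u) →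
      (∃ x ∈ halfTree φ c (-1), x ∈ halfTree φ g u) → False := by
    rintro g c u ⟨x, hx, hx'⟩ ⟨y, hy, hy'⟩
    have h1 := (eq_and_mem_of_mem_halfTree hx' hx).1
    have h2 := (eq_and_mem_of_mem_halfTree hy' hy).1
    exact absurd (h1.symm.trans h2) (by decide)
  by_contra! H
  have H' : ∀ c v, (∃ x ∈ halfTree φ c v, x ∈ halfTree φ g₁ u₁) ∨
      (∃ x ∈ halfTree φ c v, x ∈ halfTree φ g₂ u₂) ∨
      (∃ x ∈ halfTree φ c v, x ∈ halfTree φ g₃ u₃) := by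
    intro c v
    obtain ⟨x, hx, h⟩ := H c v
    by_cases h1 : x ∈ halfTree φ g₁ u₁
    · exact Or.inl ⟨x, hx, h1⟩
    by_cases h2 : x ∈ halfTree φ g₂ u₂
    · exact Or.inr (Or.inl ⟨x, hx, h2⟩)
    · exact Or.inr (Or.inr ⟨x, hx, h h1 h2⟩)
  rcases H' 1 1 with h1 | h1 | h1 <;> rcases H' a 1 with h2 | h2 | h2 <;>
    rcases H' 1 (-1) with h3 | h3 | h3 <;>
    first
    | exact key _ _ _ _ h1 h2
    | exact key _ _ _ _ h3 h2
    | exact key' _ _ _ h1 h3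
    | rcases H' a (-1) with h4 | h4 | h4 <;>
      first
      | exact key _ _ _ _ h1 h4
      | exact key _ _ _ _ h3 h4
      | exact key' _ _ _ h2 h4

/-- Finds a vertex beyond the edge `(1, u)` that `f` does not fix: first `t ^ u * a` is tried, and
if `f` fixes that vertex, faithfulness supplies a further power of `t` to follow. -/
theorem exists_conj_notMem_range {a : G} (ha : ∀ u, a ∉ toSubgroup A B u)
    (hfaith : ∀ g : G, g ≠ 1 → ∃ (v : ℤˣ) (n : ℕ),
      ((t ^ (v : ℤ)) ^ n)⁻¹ * of g * (t ^ (v : ℤ)) ^ n ∉ (of.range : Subgroup (HNNExtension G A B φ)))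
    {f : HNNExtension G A B φ} (hf : f ≠ 1) (u : ℤˣ) :
    ∃ y : HNNExtension G A B φ, y⁻¹ * f * y ∉ (of.range : Subgroup (HNNExtension G A B φ)) ∧
      ∃ g v, ∀ x ∉ halfTree φ g v, y * x ∈ halfTree φ 1 u := by
  by_cases h : (t ^ (u : ℤ) * of a)⁻¹ * f * (t ^ (u : ℤ) * of a) ∈
    (of.range : Subgroup (HNNExtension G A B φ))
  · obtain ⟨g, hg⟩ := h
    have hg1 : g ≠ 1 := by
      rintro rfl
      rw [map_one, eq_comm, mul_assoc, inv_mul_eq_one, right_eq_mul] at hg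
      exact hf hg
    obtain ⟨v, n, hn⟩ := hfaith g hg1
    refine ⟨(t ^ (u : ℤ) * of a) * (t ^ (v : ℤ)) ^ n, ?_, 1, -v, fun x hx => ?_⟩
    · rw [hg] at hn
      convert hn using 1
      simp only [mul_inv_rev, mul_assoc]
    · cases n with
      | zero => exact absurd ⟨g, by simp⟩ hn
      | succ n =>
        have h1 := of_mul_mem_halfTree a (t_zpow_pow_mul_mem_halfTree n hx)
        have h2 := t_zpow_mul_mem_halfTree
          (halfTree_disjoint_of_notMem (g := 1) v (-u) ha (by simpa using h1))
        simpa [mul_assoc] using h2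
  · refine ⟨_, h, a⁻¹, -u, fun x hx => ?_⟩
    rw [mul_assoc]
    refine t_zpow_mul_mem_halfTree fun h => hx ?_
    simpa using of_mul_mem_halfTree a⁻¹ h

theorem isDisplacing_halfTrees {a : G} (ha : ∀ u, a ∉ toSubgroup A B u)
    (hfaith : ∀ g : G, g ≠ 1 → ∃ (v : ℤˣ) (n : ℕ),
      ((t ^ (v : ℤ)) ^ n)⁻¹ * of g * (t ^ (v : ℤ)) ^ n ∉ (of.range : Subgroup (HNNExtension G A B φ))) :
    IsDisplacing (HNNExtension G A B φ) (halfTrees φ) := by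
  intro f hf U hU
  obtain ⟨h, u, rfl⟩ := exists_halfTrees_eq hU
  obtain ⟨y, hy, g₃, u₃, H₃⟩ := exists_conj_notMem_range ha hfaith
    (f := h * f * h⁻¹) (fun h' => hf (by simpa using h')) u
  obtain ⟨g₁, u₁, g₂, u₂, H⟩ := exists_mul_mem_halfTree _ hy
  obtain ⟨c, v, hcv⟩ := exists_forall_notMem_halfTree (φ := φ) ha g₁ g₂ g₃ u₁ u₂ u₃
  -- Avoiding `(g₃, u₃)` places the new set inside `U`. Avoiding `(g₂, u₂)` makes `f` send it into
  -- the translate of `(g₁, u₁)`, which it also avoids.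
  refine ⟨{x | y⁻¹ * h * x ∈ halfTree φ c v}, ⟨_, _, _, rfl⟩, fun x hx => ?_, fun x hx hx' => ?_⟩
  · simpa [mul_assoc] using H₃ _ (hcv _ hx).2.2
  · refine (hcv _ hx').1 ?_
    simpa [mul_assoc] using H _ (hcv _ hx).2.1

theorem notMem_range_of_mem_halfTree {g : G} {u : ℤˣ} {x : HNNExtension G A B φ}
    (hx : x ∈ halfTree φ g u) : x ∉ (of.range : Subgroup (HNNExtension G A B φ)) := by
  obtain ⟨w, rfl, hw, -⟩ := hx
  intro h
  rw [ReducedWord.toList_eq_nil_of_mem_of_range φ w h] at hw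
  simp at hw

theorem t_zpow_conj_of_notMem_range {g : G} {u : ℤˣ} (hg : g ∉ toSubgroup A B u) :
    t ^ (u : ℤ) * of g * (t ^ (u : ℤ))⁻¹ ∉ (of.range : Subgroup (HNNExtension G A B φ)) := by
  have h1 : (t ^ (u : ℤ))⁻¹ * 1 ∈ halfTree φ 1 (-u) :=
    t_zpow_inv_mul_mem_halfTree fun h => notMem_range_of_mem_halfTree h (one_mem _)
  have h2 := of_mul_mem_halfTree g h1
  have h3 : of g * ((t ^ (u : ℤ))⁻¹ * 1) ∉ halfTree φ 1 (-u) := fun h => by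
    have := (eq_and_mem_of_mem_halfTree h h2).2
    exact hg (by simpa using this)
  have := notMem_range_of_mem_halfTree (t_zpow_mul_mem_halfTree h3)
  simpa [mul_assoc] using this

end HNNExtension

/-! ### Baumslag–Solitar groups as HNN extensions -/

namespace BaumslagSolitar

open HNNExtension

theorem zpowGroupHom_injective {m : ℤ} (hm : m ≠ 0) :
    Function.Injective (zpowGroupHom m : Multiplicative ℤ →* Multiplicative ℤ) := by
  intro x y h
  exact Multiplicative.toAdd.injective (mul_left_cancel₀ hm (by
    simpa using congrArg Multiplicative.toAdd h))

/-- The isomorphism `b ^ (m * k) ↦ b ^ (n * k)` between subgroups of an infinite cyclic group. -/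
noncomputable def powEquiv {m n : ℤ} (hm : m ≠ 0) (hn : n ≠ 0) :
    (zpowGroupHom m : Multiplicative ℤ →* Multiplicative ℤ).range ≃*
      (zpowGroupHom n : Multiplicative ℤ →* Multiplicative ℤ).range :=
  (MonoidHom.ofInjective (zpowGroupHom_injective hm)).symm.trans
    (MonoidHom.ofInjective (zpowGroupHom_injective hn))

theorem powEquiv_apply {m n : ℤ} (hm : m ≠ 0) (hn : n ≠ 0) (x : Multiplicative ℤ) :
    (powEquiv hm hn ⟨x ^ m, x, rfl⟩ : Multiplicative ℤ) = x ^ n := by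
  have : (⟨x ^ m, x, rfl⟩ : (zpowGroupHom m : Multiplicative ℤ →* Multiplicative ℤ).range) =
      MonoidHom.ofInjective (zpowGroupHom_injective hm) x := rfl
  rw [powEquiv, MulEquiv.trans_apply, this, MulEquiv.symm_apply_apply]
  rfl

/-- The HNN extension of an infinite cyclic group which is isomorphic to `BS m n`. -/
abbrev HNN {m n : ℤ} (hm : m ≠ 0) (hn : n ≠ 0) : Type :=
  HNNExtension (Multiplicative ℤ) _ _ (powEquiv hm hn)

section

variable {m n : ℤ} (hm : m ≠ 0) (hn : n ≠ 0)

theorem t_mul_of_zpow (x : Multiplicative ℤ) :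
    (t : HNN hm hn) * of x ^ m = of x ^ n * t := by
  have := t_mul_of (φ := powEquiv hm hn) ⟨x ^ m, x, rfl⟩
  rwa [powEquiv_apply, map_zpow, map_zpow] at this

/-- The images of the generators of `BS m n` in the HNN extension. -/
noncomputable def genToHNN : Gen → HNN hm hn
  -- In the HNN extension `t * a = φ a * t`, whereas here `τ⁻¹` conjugates `b ^ m` to `b ^ n`; hence
  -- the inverse.
  | Gen.τ => t⁻¹
  | Gen.b => of (Multiplicative.ofAdd 1)

/-- The homomorphism from `BS m n` to the HNN extension. -/
noncomputable def toHNN : BS m n →* HNN hm hn :=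
  PresentedGroup.toGroup (f := genToHNN hm hn) (by
    rintro _ rfl
    simp [relator, genToHNN, t_mul_of_zpow])

theorem inv_τ_mul_zpow : (PresentedGroup.of Gen.τ : BS m n)⁻¹ * PresentedGroup.of Gen.b ^ m =
    PresentedGroup.of Gen.b ^ n * (PresentedGroup.of Gen.τ)⁻¹ := by
  have : PresentedGroup.mk {relator m n} (relator m n) = 1 :=
    PresentedGroup.one_of_mem (Set.mem_singleton _)
  rw [relator, map_mul, map_mul, map_mul, map_inv, map_inv, map_zpow, map_zpow,
    mul_inv_eq_one] at this
  rw [eq_mul_inv_iff_mul_eq]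
  exact this

/-- The homomorphism from the HNN extension to `BS m n`. -/
noncomputable def ofHNN : HNN hm hn →* BS m n :=
  lift (zpowersHom _ (PresentedGroup.of Gen.b)) (PresentedGroup.of Gen.τ)⁻¹ (by
    rintro ⟨_, x, rfl⟩
    have h : (powEquiv hm hn ⟨zpowGroupHom m x, x, rfl⟩ : Multiplicative ℤ) = x ^ n :=
      powEquiv_apply hm hn x
    have hs : SemiconjBy (PresentedGroup.of Gen.τ : BS m n)⁻¹ (PresentedGroup.of Gen.b ^ m)
      (PresentedGroup.of Gen.b ^ n) := inv_τ_mul_zpow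
    rw [h]
    change _ * zpowersHom _ (PresentedGroup.of Gen.b) (x ^ m) = _
    rw [map_zpow, map_zpow, zpowersHom_apply, zpow_comm, zpow_comm _ _ n]
    exact hs.zpow_right _)

/-- The group `BS m n` is an HNN extension of an infinite cyclic group. -/
noncomputable def equivHNN : BS m n ≃* HNN hm hn :=
  MonoidHom.toMulEquiv (toHNN hm hn) (ofHNN hm hn)
    (PresentedGroup.ext fun x => by
      cases x <;> simp [toHNN, ofHNN, genToHNN])
    (HNNExtension.hom_ext (MonoidHom.ext_mint (by simp [toHNN, ofHNN, genToHNN]))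
      (by simp [toHNN, ofHNN, genToHNN]))

/-- Descent on the exponent: while `x = y ^ p` stays in the associated subgroup, conjugation
replaces it by `y ^ q`, which is still non-trivial and strictly smaller in absolute value. -/
theorem exists_conj_notMem_range_of_abs_lt {p q : ℤ} {u : ℤˣ} (hpq : |q| < |p|)
    (hmem : ∀ x, x ∈ toSubgroup (zpowGroupHom m : Multiplicative ℤ →* Multiplicative ℤ).range
      (zpowGroupHom n : Multiplicative ℤ →* Multiplicative ℤ).range u → ∃ y, y ^ p = x)
    (hconj : ∀ x, (t : HNN hm hn) ^ (u : ℤ) * of (x ^ p) = of (x ^ q) * t ^ (u : ℤ))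
    (x : Multiplicative ℤ) (hx : x ≠ 1) :
    ∃ N : ℕ, (t ^ (u : ℤ)) ^ N * of x * ((t ^ (u : ℤ)) ^ N)⁻¹ ∉
      (of.range : Subgroup (HNN hm hn)) := by
  induction hk : (Multiplicative.toAdd x).natAbs using Nat.strong_induction_on generalizing x with
  | _ k ih =>
  by_cases h : x ∈ toSubgroup (zpowGroupHom m : Multiplicative ℤ →* Multiplicative ℤ).range
      (zpowGroupHom n : Multiplicative ℤ →* Multiplicative ℤ).range u
  · obtain ⟨y, rfl⟩ := hmem x h
    by_cases hy : y ^ q = 1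
    · refine absurd (of_injective (powEquiv hm hn) ?_) hx
      have := hconj y
      rw [hy, map_one, one_mul, mul_eq_left] at this
      rw [this, map_one]
    have hlt : (Multiplicative.toAdd (y ^ q)).natAbs < k := by
      have hy0 : (Multiplicative.toAdd y).natAbs ≠ 0 := by
        rw [Int.natAbs_ne_zero]
        rintro h0
        exact hx (by rw [toAdd_eq_zero.1 h0, one_zpow])
      rw [← hk, toAdd_zpow, toAdd_zpow, smul_eq_mul, smul_eq_mul, Int.natAbs_mul, Int.natAbs_mul]
      exact Nat.mul_lt_mul_of_pos_right (by rwa [Int.abs_eq_natAbs, Int.abs_eq_natAbs, Nat.cast_lt] at hpq) (Nat.pos_of_ne_zero hy0)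
    obtain ⟨N, hN⟩ := ih _ hlt _ hy rfl
    refine ⟨N + 1, ?_⟩
    convert hN using 1
    rw [eq_mul_inv_iff_mul_eq.2 (hconj y).symm]
    simp only [pow_succ, mul_assoc, mul_inv_rev]
  · exact ⟨1, by simpa using t_zpow_conj_of_notMem_range h⟩

theorem exists_conj_notMem_range_of_abs_ne (hne : |m| ≠ |n|) (x : Multiplicative ℤ) (hx : x ≠ 1) :
    ∃ (v : ℤˣ) (N : ℕ), ((t ^ (v : ℤ)) ^ N)⁻¹ * of x * (t ^ (v : ℤ)) ^ N ∉
      (of.range : Subgroup (HNN hm hn)) := by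
  rcases hne.lt_or_gt with h | h
  · obtain ⟨N, hN⟩ := exists_conj_notMem_range_of_abs_lt hm hn (u := -1) h
      (fun _ => MonoidHom.mem_range.1) (fun x => by
        have := t_mul_of_zpow hm hn x
        rw [← map_zpow, ← map_zpow] at this
        simp only [Units.val_neg, Units.val_one, zpow_neg, zpow_one]
        rw [inv_mul_eq_iff_eq_mul, ← mul_assoc, this, mul_inv_cancel_right]) x hx
    exact ⟨1, N, by simpa using hN⟩
  · obtain ⟨N, hN⟩ := exists_conj_notMem_range_of_abs_lt hm hn (u := 1) h
      (fun _ => MonoidHom.mem_range.1) (fun x => by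
        simpa using t_mul_of_zpow hm hn x) x hx
    exact ⟨-1, N, by simpa using hN⟩

theorem ofAdd_one_notMem_toSubgroup (hm : 2 ≤ |m|) (hn : 2 ≤ |n|) (u : ℤˣ) :
    Multiplicative.ofAdd (1 : ℤ) ∉
      toSubgroup (zpowGroupHom m : Multiplicative ℤ →* Multiplicative ℤ).range
        (zpowGroupHom n : Multiplicative ℤ →* Multiplicative ℤ).range u := by
  have key : ∀ k : ℤ, 2 ≤ |k| → Multiplicative.ofAdd (1 : ℤ) ∉
      (zpowGroupHom k : Multiplicative ℤ →* Multiplicative ℤ).range := by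
    rintro k hk ⟨y, hy⟩
    have h1 : k * Multiplicative.toAdd y = 1 := by
      simpa using congrArg Multiplicative.toAdd hy
    rw [Int.isUnit_iff_abs_eq.1 (IsUnit.of_mul_eq_one _ h1)] at hk
    omega
  rcases Int.units_eq_one_or u with rfl | rfl
  · exact key m hm
  · exact key n hn

end

end BaumslagSolitar

/-! ### Transport along the isomorphism and conclusion -/

theorem CompressesComplements.comap {G G' X : Type*} [Group G] [Group G'] [MulAction G' X]
    (e : G ≃* G') {𝓑 : Set (Set X)} (h : CompressesComplements (⊤ : Subgroup G') 𝓑) :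
    letI := MulAction.compHom X e.toMonoidHom
    CompressesComplements (⊤ : Subgroup G) 𝓑 := by
  intro U hU
  obtain ⟨g, -, hg⟩ := h U hU
  refine ⟨e.symm g, trivial, fun j hj x hx => ?_⟩
  change e (e.symm g ^ j) • x ∈ U
  rw [map_zpow, e.apply_symm_apply]
  exact hg j hj x hx

theorem IsDisplacing.comap {G G' X : Type*} [Group G] [Group G'] [MulAction G' X]
    (e : G ≃* G') {𝓑 : Set (Set X)} (h : IsDisplacing G' 𝓑) :
    letI := MulAction.compHom X e.toMonoidHom
    IsDisplacing G 𝓑 := by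
  intro f hf U hU
  exact h (e f) (by simpa using hf) U hU

theorem corollary1p7 (m n : ℤ) (hmin : 2 ≤ min |m| |n|) (hne : |m| ≠ |n|) :
    IsStronglyPowersGroup (BaumslagSolitar.SBS m n) := by
  obtain ⟨hm2, hn2⟩ := le_min_iff.1 hmin
  have hm : m ≠ 0 := by rintro rfl; simp at hm2
  have hn : n ≠ 0 := by rintro rfl; simp at hn2
  have ha := BaumslagSolitar.ofAdd_one_notMem_toSubgroup hm2 hn2
  let e := BaumslagSolitar.equivHNN hm hn
  let := MulAction.compHom (BaumslagSolitar.HNN hm hn) e.toMonoidHom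
  have hd : IsDisplacing (BaumslagSolitar.BS m n)
      (HNNExtension.halfTrees (BaumslagSolitar.powEquiv hm hn)) :=
    (HNNExtension.isDisplacing_halfTrees ha
      (BaumslagSolitar.exists_conj_notMem_range_of_abs_ne hm hn hne)).comap e
  have hc : CompressesComplements (⊤ : Subgroup (BaumslagSolitar.BS m n))
      (HNNExtension.halfTrees (BaumslagSolitar.powEquiv hm hn)) :=
    (HNNExtension.compressesComplements_halfTrees ha).comap e
  intro N hN hne
  have h𝓑 : (HNNExtension.halfTrees (BaumslagSolitar.powEquiv hm hn)).Nonempty :=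
    ⟨_, 1, 1, 1, rfl⟩
  refine hd.isStronglyPowersGroup h𝓑 (hc.of_normal hd ?_ ?_) N hN hne
  · intro k hk h _
    exact (MonoidHom.normal_ker _).conj_mem k hk h
  -- The kernel is non-trivial because it contains the given non-trivial subnormal subgroup.
  · intro h
    have : Subsingleton (BaumslagSolitar.SBS m n) := by
      rw [h]; infer_instance
    exact hne (Subsingleton.elim _ _)
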